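/- Let $d\in\mathbb N_0$, $T>0$, and let $L^2(\mathbb R^d)$, $L^\infty(\mathbb R^d)$ be the Lebesgue spaces of real- (or complex-) valued functions. Let $\mathcal I$ be the set of finitely supported sequences $\gamma=(\gamma_1,\gamma_2,\dots)$ of non-negative integers, $(2\mathbb N)^{\gamma}=\prod_{k\ge1}(2k)^{\gamma_k}$, and let $H_\gamma$, $\gamma\in\mathcal I$, be the Fourier–Hermite polynomials on the Gaussian white noise space. For a normed space $Y$ and $p\ge 0$, $Y\otimes(S)_{-p}$ is the space of formal chaos expansions $F=\sum_{\gamma\in\mathcal I}f_\gamma H_\gamma$, $f_\gamma\in Y$, with $\sum_{\gamma}\|f_\gamma\|_Y^2(2\mathbb N)^{-p\gamma}<\infty$, and $Y\otimes(S)_{-1}=\bigcup_{p\ge0}Y\otimes(S)_{-p}$. Assume: (H1) $\mathcal L$ is a closed (in general unbounded) linear operator on $L^2(\mathbb R^d)$ with dense domain $D$ which generates a $C_0$-semigroup on $L^2(\mathbb R^d)$; it acts on expansions by $\mathcal L\sum_\gamma u_\gamma H_\gamma=\sum_\gamma(\mathcal L u_\gamma)H_\gamma$. (H2) $F=\sum_\gamma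 f_\gamma H_\gamma\in C([0,T];L^2(\mathbb R^d))\otimes(S)_{-1}$, and every $f_\gamma:[0,T]\to L^2(\mathbb R^d)$ is Lipschitz continuous. (H3) $G=\sum_\gamma g_\gamma H_\gamma\in D\otimes(S)_{-1}$. Here $D$ carries the norm of $L^2(\mathbb R^d)$, and $C([0,T];D)$ is the space of continuous functions $[0,T]\to L^2(\mathbb R^d)$ with values in $D$, with the supremum norm. Let $q\in L^\infty(\mathbb R^d)$. Then there is a unique $U=\sum_\gamma u_\gamma H_\gamma\in C([0,T];D)\otimes(S)_{-1}$ which solves $$\Big(\frac{\partial}{\partial t}-\mathcal L\Big)U+q\cdot U=F\quad(0<t\le T),\qquad U|_{t=0}=G,$$ where the time derivative (in $L^2(\mathbb R^d)$, one-sided at $t=T$), $\mathcal L$ and the multiplication by $q$ act on the coefficients, and the equation is an identity of chaos expansions for every $t\in(0,T]$. Moreover, for every $\gamma\in\mathcal I$ the coefficient $u_\gamma$ is the unique solution in $C([0,T];D)$ of the deterministic problem $$\Big(\frac{\partial}{\partial t}-\mathcal L\Big)u_\gamma+q\,u_\gamma=f_\gamma\quad(0<t\le T),\qquad u_\gamma(0)=g_\gamma,$$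 the function $t\mapsto\mathcal L u_\gamma(t)$ is continuous from $[0,T]$ to $L^2(\mathbb R^d)$ (so $u_\gamma$ is continuous for the graph norm of $D$ as well), and whenever $F\in C([0,T];L^2(\mathbb R^d))\otimes(S)_{-p_1}$ and $G\in D\otimes(S)_{-p_2}$ with $p_1,p_2\ge0$, one has $U\in C([0,T];D)\otimes(S)_{-r}$ for every $r\ge\max(p_1,p_2)$. -/

import Mathlib

open MeasureTheory Filter Topology

noncomputable section

namespace StochParabolic

/-! ### Function spaces on `ℝ^d` -/

/-- The Lebesgue space `L²(ℝ^d)` (real- or complex-valued, according to `𝕜`). -/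
abbrev L2 (𝕜 : Type) [RCLike 𝕜] (d : ℕ) : Type :=
  Lp 𝕜 2 (volume : Measure (EuclideanSpace ℝ (Fin d)))

/-- The Lebesgue space `L^∞(ℝ^d)`. -/
abbrev LInf (𝕜 : Type) [RCLike 𝕜] (d : ℕ) : Type :=
  Lp 𝕜 ⊤ (volume : Measure (EuclideanSpace ℝ (Fin d)))

/-- Pointwise multiplication `u ↦ q · u` of an `L²` function by an `L^∞` function. -/
def potentialMul {𝕜 : Type} [RCLike 𝕜] {d : ℕ} (q : LInf 𝕜 d) (u : L2 𝕜 d) : L2 𝕜 d :=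
  q • u

/-- The multiplication by the potential is the almost everywhere pointwise product. -/
theorem coeFn_potentialMul {𝕜 : Type} [RCLike 𝕜] {d : ℕ} (q : LInf 𝕜 d) (u : L2 𝕜 d) :
    (potentialMul q u : EuclideanSpace ℝ (Fin d) → 𝕜) =ᵐ[volume] fun x => q x * u x :=
  Lp.coeFn_lpSMul q u

/-! ### Strongly continuous semigroups and their generators -/

/-- A `C₀`-semigroup `(T_t)_{t ≥ 0}` of bounded operators on `H`. The values at negative times
play no role. -/
structure C0Semigroup (𝕜 : Type) [RCLike 𝕜] (H : Type) [NormedAddCommGroup H]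
    [NormedSpace 𝕜 H] where
  /-- the operators `T_t` -/
  op : ℝ → H →L[𝕜] H
  op_zero : op 0 = ContinuousLinearMap.id 𝕜 H
  op_add : ∀ s t : ℝ, 0 ≤ s → 0 ≤ t → op (s + t) = (op s).comp (op t)
  tendsto_zero : ∀ x : H, Tendsto (fun t : ℝ => op t x) (𝓝[>] 0) (𝓝 x)

/-- `L` is the infinitesimal generator of `S`: the pair `(x, y)` is in the graph of `L` (that is,
`x ∈ D(L)` and `L x = y`) if and only if `(S_t x - x) / t → y` as `t → 0+`. -/
def C0Semigroup.IsGeneratedBy {𝕜 : Type} [RCLike 𝕜] {H : Type} [NormedAddCommGroup H]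
    [NormedSpace 𝕜 H] [NormedSpace ℝ H] (S : C0Semigroup 𝕜 H) (L : H →ₗ.[𝕜] H) : Prop :=
  ∀ x y : H, (x, y) ∈ L.graph ↔
    Tendsto (fun t : ℝ => t⁻¹ • (S.op t x - x)) (𝓝[>] 0) (𝓝 y)

/-- The hypothesis on the operator: `L` is closed, densely defined, and generates a
`C₀`-semigroup. -/
structure IsAdmissibleOperator {𝕜 : Type} [RCLike 𝕜] {H : Type} [NormedAddCommGroup H]
    [NormedSpace 𝕜 H] [NormedSpace ℝ H] (L : H →ₗ.[𝕜] H) : Prop where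
  closed : L.IsClosed
  dense : Dense (L.domain : Set H)
  generates : ∃ S : C0Semigroup 𝕜 H, S.IsGeneratedBy L

/-! ### Chaos expansions and generalized stochastic processes of Kondratiev type -/

/-- The set `𝓘` of multi-indices: sequences of non-negative integers with finitely many nonzero
components. The component of number `k ≥ 1` is stored at position `k - 1`. -/
abbrev MultiIndex : Type := ℕ →₀ ℕ

/-- `(2ℕ)^γ = ∏_{k ≥ 1} (2k)^{γ_k}`. -/
def kondratievWeight (γ : MultiIndex) : ℝ :=
  γ.prod fun k n => (2 * ((k : ℝ) + 1)) ^ n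

/-- Formal expansions `∑_γ f_γ H_γ` along the Fourier-Hermite polynomials `H_γ`, with coefficients
in `Y`. -/
abbrev ChaosExpansion (Y : Type) : Type := MultiIndex → Y

/-- The formal expansion `∑_γ f_γ H_γ` belongs to `Y ⊗ (S)_{-p}`:
`∑_γ ‖f_γ‖² (2ℕ)^{-pγ} < ∞`. -/
def ChaosExpansion.MemKondratiev {Y : Type} [NormedAddCommGroup Y] (f : ChaosExpansion Y)
    (p : ℝ) : Prop :=
  Summable fun γ : MultiIndex => ‖f γ‖ ^ 2 * kondratievWeight γ ^ (-p)

/-- The space `Y ⊗ (S)_{-1} = ⋃_{p ≥ 0} Y ⊗ (S)_{-p}` of `Y`-valued generalized stochastic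
processes of Kondratiev type. -/
@[ext]
structure KondratievProcess (Y : Type) [NormedAddCommGroup Y] where
  /-- the coefficients of the chaos expansion -/
  coeff : ChaosExpansion Y
  exists_mem : ∃ p : ℝ, 0 ≤ p ∧ coeff.MemKondratiev p

/-- The action of an operator on a chaos expansion: `L (∑_γ u_γ H_γ) = ∑_γ (L u_γ) H_γ`. -/
def ChaosExpansion.applyOp {𝕜 : Type} [RCLike 𝕜] {H : Type} [NormedAddCommGroup H]
    [NormedSpace 𝕜 H] (L : H →ₗ.[𝕜] H) (u : ChaosExpansion L.domain) : ChaosExpansion H :=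
  fun γ => L (u γ)

/-- The product of a (deterministic) potential with a chaos expansion:
`q · ∑_γ u_γ H_γ = ∑_γ (q u_γ) H_γ`. -/
def ChaosExpansion.mulPotential {𝕜 : Type} [RCLike 𝕜] {d : ℕ} (q : LInf 𝕜 d)
    (u : ChaosExpansion (L2 𝕜 d)) : ChaosExpansion (L2 𝕜 d) :=
  fun γ => potentialMul q (u γ)

/-- The value at time `t` of a process with values in continuous functions of time, as a chaos
expansion: `U(t) = ∑_γ u_γ(t) H_γ`. -/
def KondratievProcess.atTime {Y : Type} [NormedAddCommGroup Y] {T : ℝ}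
    (U : KondratievProcess C(Set.Icc (0 : ℝ) T, Y)) (t : Set.Icc (0 : ℝ) T) : ChaosExpansion Y :=
  fun γ => U.coeff γ t

/-! ### Time derivatives -/

/-- The initial time, as a point of `[0, T]`. -/
def initialTime {T : ℝ} (hT : 0 ≤ T) : Set.Icc (0 : ℝ) T := ⟨0, le_rfl, hT⟩

/-- `v` is the derivative of the function `u : [0, T] → H` at the time `t ∈ [0, T]` (one-sided at
the end points), in the norm of `H`. -/
def HasTimeDeriv {H : Type} [NormedAddCommGroup H] [NormedSpace ℝ H] {T : ℝ} (hT : 0 ≤ T)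
    (u : Set.Icc (0 : ℝ) T → H) (v : H) (t : Set.Icc (0 : ℝ) T) : Prop :=
  HasDerivWithinAt (fun s : ℝ => u (Set.projIcc 0 T hT s)) v (Set.Icc 0 T) (t : ℝ)

/-- `V = ∑_γ v_γ H_γ` is the time derivative at the time `t` of `U = ∑_γ u_γ H_γ`, i.e.
`v_γ = ∂_t u_γ (t)` for every `γ`. -/
def HasChaosTimeDeriv {H : Type} [NormedAddCommGroup H] [NormedSpace ℝ H] {T : ℝ} (hT : 0 ≤ T)
    (U : Set.Icc (0 : ℝ) T → ChaosExpansion H) (V : ChaosExpansion H)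
    (t : Set.Icc (0 : ℝ) T) : Prop :=
  ∀ γ : MultiIndex, HasTimeDeriv hT (fun s => U s γ) (V γ) t

/-! ### The deterministic and the stochastic initial value problem

The domain `D` of `L` is regarded as a normed subspace of `L²(ℝ^d)`, so that `C([0,T]; D)` is the
space of functions which are continuous from `[0,T]` to `L²(ℝ^d)` and take their values in `D`. -/

/-- `u ∈ C([0,T]; D)` solves `(∂_t - L) u + q u = f` on `(0, T]`, `u(0) = g`. -/
structure IsDeterministicSolution {𝕜 : Type} [RCLike 𝕜] {d : ℕ} {T : ℝ} (hT : 0 ≤ T)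
    (L : L2 𝕜 d →ₗ.[𝕜] L2 𝕜 d) (q : LInf 𝕜 d) (f : C(Set.Icc (0 : ℝ) T, L2 𝕜 d))
    (g : L.domain) (u : C(Set.Icc (0 : ℝ) T, L.domain)) : Prop where
  initial : u (initialTime hT) = g
  equation : ∀ t : Set.Icc (0 : ℝ) T, 0 < (t : ℝ) →
    ∃ v : L2 𝕜 d, HasTimeDeriv hT (fun s => (u s : L2 𝕜 d)) v t ∧
      (v - L (u t)) + potentialMul q (u t : L2 𝕜 d) = f t

/-- The process `U ∈ C([0,T]; D) ⊗ (S)_{-1}` solves `(∂_t - L) U + q · U = F` on `(0, T]`,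
`U(0) = G`, as identities of chaos expansions. -/
structure IsStochasticSolution {𝕜 : Type} [RCLike 𝕜] {d : ℕ} {T : ℝ} (hT : 0 ≤ T)
    (L : L2 𝕜 d →ₗ.[𝕜] L2 𝕜 d) (q : LInf 𝕜 d)
    (F : KondratievProcess C(Set.Icc (0 : ℝ) T, L2 𝕜 d)) (G : KondratievProcess L.domain)
    (U : KondratievProcess C(Set.Icc (0 : ℝ) T, L.domain)) : Prop where
  initial : U.atTime (initialTime hT) = G.coeff
  equation : ∀ t : Set.Icc (0 : ℝ) T, 0 < (t : ℝ) →
    ∃ V : ChaosExpansion (L2 𝕜 d),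
      HasChaosTimeDeriv hT (fun s γ => (U.atTime s γ : L2 𝕜 d)) V t ∧
      (V - ChaosExpansion.applyOp L (U.atTime t)) +
        ChaosExpansion.mulPotential q (fun γ => (U.atTime t γ : L2 𝕜 d)) = F.atTime t

end StochParabolic

end

/-! Since `L` and `q` are deterministic, the stochastic equation is a family of uncoupled problems
u' = L u + B u + f with B = -q bounded on L². It remains to solve each one and to bound its solution
by C (‖g‖ + ‖f‖) with one C for all γ; summability then passes from the data to the solution with
the same weights.

Uniqueness and the bound: differentiating s ↦ S_{t-s} u(s) shows that a solution is mild, u(t) = S_t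
u(0) + ∫₀ᵗ S_{t-s} (B u + f) ds, and Grönwall's inequality gives C, which depends only on T, ‖q‖ and
a bound for S on [0,T]. Apply this to the difference of two solutions
(`IsGeneratedBy.eq_flow_add_duhamel`, `norm_le_of_eq_duhamel`).

Existence: a Lipschitz f with values in a Hilbert space is the integral of an integrable f'. The
derivative w = u' should satisfy the differentiated equation w(t) = S_t x + ∫₀ᵗ S_{t-s} (f' + B w)
ds with x = L g + B g + f(0). This Volterra equation has a continuous solution; put u = g + ∫ w.
Closedness of L shows that u takes values in D and that the equation holds
(`IsGeneratedBy.exists_solution`). -/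

noncomputable section

namespace StochParabolic

/-! ### Local boundedness and joint continuity of C₀-semigroups. -/

namespace C0Semigroup

variable {𝕜 : Type} [RCLike 𝕜] {H : Type} [NormedAddCommGroup H] [NormedSpace 𝕜 H]

theorem tendsto_op_nhdsGE_zero (S : C0Semigroup 𝕜 H) (x : H) :
    Tendsto (fun t : ℝ => S.op t x) (𝓝[≥] 0) (𝓝 x) := by
  rw [← Set.Ioi_insert, nhdsWithin_insert, tendsto_sup]
  refine ⟨tendsto_pure_left.2 fun s hs => ?_, S.tendsto_zero x⟩
  simpa [S.op_zero] using mem_of_mem_nhds hs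

/-- The operators of a `C₀`-semigroup are uniformly bounded near time zero. -/
theorem exists_norm_op_le_near_zero [CompleteSpace H] (S : C0Semigroup 𝕜 H) :
    ∃ δ > 0, ∃ M : ℝ, ∀ t ∈ Set.Icc (0 : ℝ) δ, ‖S.op t‖ ≤ M := by
  by_contra! h
  -- Otherwise some t_n → 0 has ‖S_{t_n}‖ > n, although every orbit S_{t_n} x converges to x; this
  -- contradicts Banach–Steinhaus.
  have h' : ∀ n : ℕ, ∃ t ∈ Set.Icc (0 : ℝ) (1 / ((n : ℝ) + 1)), (n : ℝ) < ‖S.op t‖ :=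
    fun n => h _ (by positivity) n
  choose t ht hn using h'
  have ht0 : Tendsto t atTop (𝓝[≥] 0) := by
    refine tendsto_nhdsWithin_iff.2 ⟨?_, Eventually.of_forall fun n => (ht n).1⟩
    exact squeeze_zero (fun n => (ht n).1) (fun n => (ht n).2)
      tendsto_one_div_add_atTop_nhds_zero_nat
  obtain ⟨C, hC⟩ := banach_steinhaus (g := fun n => S.op (t n)) fun x => by
    obtain ⟨C, hC⟩ := (((S.tendsto_op_nhdsGE_zero x).comp ht0).norm.bddAbove_range)
    exact ⟨C, fun n => hC ⟨n, rfl⟩⟩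
  obtain ⟨n, hn'⟩ := exists_nat_gt C
  linarith [hn n, hC n]

/-- The operators of a `C₀`-semigroup are uniformly bounded on bounded time intervals. -/
theorem exists_norm_op_le [CompleteSpace H] (S : C0Semigroup 𝕜 H) (T : ℝ) :
    ∃ M : ℝ, 0 ≤ M ∧ ∀ t ∈ Set.Icc (0 : ℝ) T, ‖S.op t‖ ≤ M := by
  obtain ⟨δ, hδ, M, hM⟩ := S.exists_norm_op_le_near_zero
  have key : ∀ n : ℕ, ∃ C : ℝ, 0 ≤ C ∧ ∀ t ∈ Set.Icc (0 : ℝ) (n * δ), ‖S.op t‖ ≤ C := by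
    intro n
    induction n with
    | zero =>
      refine ⟨‖S.op 0‖, norm_nonneg _, fun t ht => ?_⟩
      have : t = 0 := le_antisymm (by simpa using ht.2) ht.1
      rw [this]
    | succ n ih =>
      obtain ⟨C, hC0, hC⟩ := ih
      have hM0 : 0 ≤ M := (norm_nonneg _).trans (hM 0 ⟨le_rfl, hδ.le⟩)
      -- `M` serves the times up to δ; later ones factor as S_δ S_{t-δ}.
      refine ⟨max M (M * C), le_max_of_le_left hM0, fun t ht => ?_⟩
      rcases le_total t δ with htδ | htδ
      · exact (hM t ⟨ht.1, htδ⟩).trans (le_max_left _ _)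
      · have hmem : t - δ ∈ Set.Icc (0 : ℝ) (n * δ) := by
          refine ⟨by linarith, ?_⟩
          have := ht.2
          push_cast at this
          linarith
        have : S.op t = (S.op δ).comp (S.op (t - δ)) := by
          rw [← S.op_add _ _ hδ.le hmem.1]
          congr 1
          ring
        rw [this]
        refine ((ContinuousLinearMap.opNorm_comp_le _ _).trans ?_).trans (le_max_right _ _)
        exact mul_le_mul (hM δ ⟨hδ.le, le_rfl⟩) (hC _ hmem) (norm_nonneg _) hM0
  obtain ⟨n, hn⟩ := exists_nat_ge (T / δ)
  obtain ⟨C, hC0, hC⟩ := key n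
  exact ⟨C, hC0, fun t ht => hC t ⟨ht.1, ht.2.trans ((div_le_iff₀ hδ).1 hn)⟩⟩

theorem op_zero_apply (S : C0Semigroup 𝕜 H) (x : H) : S.op 0 x = x := by simp [S.op_zero]

theorem op_add_apply (S : C0Semigroup 𝕜 H) {s t : ℝ} (hs : 0 ≤ s) (ht : 0 ≤ t) (x : H) :
    S.op (s + t) x = S.op s (S.op t x) := by simp [S.op_add s t hs ht]

/-- The map `(t, x) ↦ S_t x`, frozen at `t = 0` for negative times. -/
def flow (S : C0Semigroup 𝕜 H) (t : ℝ) (x : H) : H := S.op (max t 0) x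

theorem flow_of_nonneg (S : C0Semigroup 𝕜 H) {t : ℝ} (ht : 0 ≤ t) (x : H) :
    S.flow t x = S.op t x := by rw [flow, max_eq_left ht]

/-- Factoring out the operator at the earlier time reduces continuity at any time to continuity at
zero. -/
theorem norm_op_sub_op_le (S : C0Semigroup 𝕜 H) {M T s t : ℝ}
    (hM : ∀ t ∈ Set.Icc (0 : ℝ) T, ‖S.op t‖ ≤ M) (hs : s ∈ Set.Icc (0 : ℝ) T)
    (ht : t ∈ Set.Icc (0 : ℝ) T) (x : H) :
    ‖S.op s x - S.op t x‖ ≤ M * ‖S.op |s - t| x - x‖ := by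
  wlog hst : t ≤ s generalizing s t
  · rw [norm_sub_rev, abs_sub_comm]
    exact this ht hs (le_of_not_ge hst)
  have : S.op s x = S.op t (S.op |s - t| x) := by
    rw [← S.op_add_apply ht.1 (abs_nonneg _), abs_of_nonneg (sub_nonneg.2 hst)]
    congr 2
    ring
  rw [this, ← map_sub]
  exact ContinuousLinearMap.le_of_opNorm_le _ (hM t ht) _

/-- A `C₀`-semigroup is jointly continuous in time and space. -/
theorem continuous_flow [CompleteSpace H] (S : C0Semigroup 𝕜 H) :
    Continuous fun p : ℝ × H => S.flow p.1 p.2 := by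
  rw [continuous_iff_continuousAt]
  rintro ⟨t, x⟩
  -- The extra 1 keeps all nearby times inside the interval where `M` is a bound.
  set T : ℝ := max t 0 + 1
  obtain ⟨M, hM0, hM⟩ := S.exists_norm_op_le T
  have hT : ∀ᶠ p : ℝ × H in 𝓝 (t, x), max p.1 0 ∈ Set.Icc (0 : ℝ) T := by
    have : ∀ᶠ p : ℝ × H in 𝓝 (t, x), max p.1 0 < T := by
      refine Tendsto.eventually_lt_const (v := max t 0) (by simp [T]) ?_
      exact (continuous_fst.max continuous_const).tendsto (t, x)
    filter_upwards [this] with p hp using ⟨le_max_right _ _, hp.le⟩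
  have hmt : max t 0 ∈ Set.Icc (0 : ℝ) T := ⟨le_max_right _ _, by simp [T]⟩
  have habs : Tendsto (fun p : ℝ × H => |max p.1 0 - max t 0|) (𝓝 (t, x)) (𝓝[≥] 0) := by
    refine tendsto_nhdsWithin_iff.2 ⟨?_, Eventually.of_forall fun p => Set.mem_Ici.2 (abs_nonneg _)⟩
    have : Continuous fun p : ℝ × H => |max p.1 0 - max t 0| := by fun_prop
    simpa using this.tendsto (t, x)
  rw [ContinuousAt, tendsto_iff_norm_sub_tendsto_zero]
  refine squeeze_zero' (g := fun p : ℝ × H =>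
    M * ‖p.2 - x‖ + M * ‖S.op |max p.1 0 - max t 0| x - x‖)
    (Eventually.of_forall fun p => norm_nonneg _) ?_ ?_
  · filter_upwards [hT] with p hp
    have : S.flow p.1 p.2 - S.flow t x =
        S.op (max p.1 0) (p.2 - x) + (S.op (max p.1 0) x - S.op (max t 0) x) := by
      simp [flow]
    rw [this]
    exact (norm_add_le _ _).trans (add_le_add
      (ContinuousLinearMap.le_of_opNorm_le _ (hM _ hp) _) (S.norm_op_sub_op_le hM hp hmt x))
  · have h1 : Tendsto (fun p : ℝ × H => ‖p.2 - x‖) (𝓝 (t, x)) (𝓝 0) := by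
      have : Continuous fun p : ℝ × H => ‖p.2 - x‖ := by fun_prop
      simpa using this.tendsto (t, x)
    have h2 := tendsto_iff_norm_sub_tendsto_zero.1 ((S.tendsto_op_nhdsGE_zero x).comp habs)
    simpa using (h1.const_mul M).add (h2.const_mul M)

end C0Semigroup

/-! ### Integration tools. -/

/-- Exchange of the order of integration over a triangle. -/
theorem integral_integral_triangle {E : Type} [NormedAddCommGroup E] [NormedSpace ℝ E] {t : ℝ}
    (ht : 0 ≤ t) {f : ℝ → ℝ → E}
    (hf : Integrable (Function.uncurry f)
      ((volume.restrict (Set.Ioc 0 t)).prod (volume.restrict (Set.Ioc 0 t)))) :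
    ∫ τ in (0 : ℝ)..t, ∫ s in (0 : ℝ)..τ, f τ s = ∫ s in (0 : ℝ)..t, ∫ τ in s..t, f τ s := by
  -- Fubini on the square, with the indicator of s < τ; the missing diagonal point is a null set in
  -- each slice.
  have hswap := integral_integral_swap (f := fun τ s =>
      Set.indicator {p : ℝ × ℝ | p.2 < p.1} (Function.uncurry f) (τ, s))
    (hf.indicator (measurableSet_lt measurable_snd measurable_fst))
  rw [intervalIntegral.integral_of_le ht, intervalIntegral.integral_of_le ht]
  refine Eq.trans (setIntegral_congr_fun measurableSet_Ioc fun τ hτ => ?_)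
    (hswap.trans (setIntegral_congr_fun measurableSet_Ioc fun s hs => ?_))
  · have : (fun s => Set.indicator {p : ℝ × ℝ | p.2 < p.1} (Function.uncurry f) (τ, s)) =
        Set.indicator (Set.Iio τ) (f τ) := by
      ext s
      simp [Set.indicator_apply]
    simp only [this]
    rw [setIntegral_indicator measurableSet_Iio, intervalIntegral.integral_of_le hτ.1.le,
      integral_Ioc_eq_integral_Ioo]
    congr 2
    ext s
    simp only [Set.mem_Ioo, Set.mem_inter_iff, Set.mem_Ioc, Set.mem_Iio]
    exact ⟨fun h => ⟨⟨h.1, h.2.le.trans hτ.2⟩, h.2⟩, fun h => ⟨h.1.1, h.2⟩⟩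
  · have : (fun τ => Set.indicator {p : ℝ × ℝ | p.2 < p.1} (Function.uncurry f) (τ, s)) =
        Set.indicator (Set.Ioi s) (fun τ => f τ s) := by
      ext τ
      simp [Set.indicator_apply]
    simp only [this]
    rw [setIntegral_indicator measurableSet_Ioi, intervalIntegral.integral_of_le hs.2]
    congr 2
    ext τ
    simp only [Set.mem_inter_iff, Set.mem_Ioc, Set.mem_Ioi]
    exact ⟨fun h => ⟨h.2, h.1.2⟩, fun h => ⟨⟨hs.1.trans h.1, h.2⟩, h.1⟩⟩

/-- The integrals of the difference quotients of a continuous function converge to its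
increment. -/
theorem tendsto_integral_differenceQuotient {E : Type} [NormedAddCommGroup E] [NormedSpace ℝ E]
    [CompleteSpace E] {f : ℝ → E} (hf : Continuous f) (t : ℝ) :
    Tendsto (fun h : ℝ => ∫ s in (0 : ℝ)..t, h⁻¹ • (f (s + h) - f s)) (𝓝[>] 0)
      (𝓝 (f t - f 0)) := by
  have hI : ∀ a b, IntervalIntegrable f volume a b := fun a b => hf.intervalIntegrable a b
  have hd : ∀ a : ℝ, Tendsto (fun h : ℝ => h⁻¹ • ∫ s in a..(a + h), f s) (𝓝[>] 0)
      (𝓝 (f a)) := by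
    intro a
    have h1 := (intervalIntegral.integral_hasDerivAt_right (hI a a)
      (hf.stronglyMeasurableAtFilter _ _) hf.continuousAt).hasDerivWithinAt (s := Set.Ioi a)
    have h2 := (hasDerivWithinAt_iff_tendsto_slope' (Set.self_notMem_Ioi)).1 h1
    have h3 : Tendsto (fun h : ℝ => a + h) (𝓝[>] 0) (𝓝[>] a) := by
      refine tendsto_nhdsWithin_iff.2 ⟨?_, ?_⟩
      · have : Continuous fun h : ℝ => a + h := by fun_prop
        simpa using (this.tendsto 0).mono_left nhdsWithin_le_nhds
      · filter_upwards [self_mem_nhdsWithin] with h hh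
        simpa using hh
    refine (h2.comp h3).congr fun h => ?_
    simp [slope]
  -- Telescoping: the integral equals h⁻¹ ∫_t^{t+h} f - h⁻¹ ∫_0^h f, so no differentiability of f is
  -- needed.
  refine ((hd t).sub (hd 0)).congr fun h => ?_
  have hs : Continuous fun s => f (s + h) := by fun_prop
  rw [← smul_sub, intervalIntegral.integral_smul,
    intervalIntegral.integral_sub (hs.intervalIntegrable _ _) (hI _ _),
    intervalIntegral.integral_comp_add_right f, zero_add]
  congr 1
  rw [sub_eq_sub_iff_add_eq_add, add_comm,
    intervalIntegral.integral_add_adjacent_intervals (hI _ _) (hI _ _), add_comm (∫ s in h.._, _),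
    intervalIntegral.integral_add_adjacent_intervals (hI _ _) (hI _ _)]

/-- A closed subspace contains the integrals of the functions with values in it. -/
theorem integral_mem_of_isClosed {𝕜 : Type} [RCLike 𝕜] {E : Type} [NormedAddCommGroup E]
    [NormedSpace 𝕜 E] [NormedSpace ℝ E] [CompleteSpace E] {V : Submodule 𝕜 E}
    (hV : IsClosed (V : Set E)) {α : Type} [MeasurableSpace α] {μ : Measure α} {f : α → E}
    (hf : Integrable f μ) (hfV : ∀ᵐ a ∂μ, f a ∈ V) : ∫ a, f a ∂μ ∈ V := by
  -- Closedness makes E ⧸ V a normed space; the integral commutes with the quotient map, which kills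
  -- `f` almost everywhere.
  have := hV
  let : NormedSpace ℝ (E ⧸ V) := NormedSpace.restrictScalars ℝ 𝕜 (E ⧸ V)
  have hmk : Continuous V.mkQ := Submodule.continuous_mkQ V
  have h := ContinuousLinearMap.integral_comp_comm (⟨V.mkQ, hmk⟩ : E →L[𝕜] E ⧸ V) hf
  rw [← Submodule.Quotient.mk_eq_zero]
  refine h.symm.trans (integral_eq_zero_of_ae ?_)
  filter_upwards [hfV] with a ha
  exact (Submodule.Quotient.mk_eq_zero V).2 ha

/-! ### The Duhamel convolution and its relation to the generator. -/

namespace C0Semigroup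

variable {𝕜 : Type} [RCLike 𝕜] {H : Type} [NormedAddCommGroup H] [NormedSpace 𝕜 H]

theorem flow_sub (S : C0Semigroup 𝕜 H) (t : ℝ) (x y : H) :
    S.flow t (x - y) = S.flow t x - S.flow t y := map_sub _ _ _

theorem flow_zero (S : C0Semigroup 𝕜 H) (x : H) : S.flow 0 x = x := by
  rw [S.flow_of_nonneg le_rfl, S.op_zero_apply]

theorem flow_add_apply (S : C0Semigroup 𝕜 H) {s t : ℝ} (hs : 0 ≤ s) (ht : 0 ≤ t) (x : H) :
    S.flow (s + t) x = S.flow s (S.flow t x) := by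
  rw [S.flow_of_nonneg (add_nonneg hs ht), S.flow_of_nonneg hs, S.flow_of_nonneg ht,
    S.op_add_apply hs ht]

theorem norm_flow_le (S : C0Semigroup 𝕜 H) {M T t : ℝ}
    (hM : ∀ t ∈ Set.Icc (0 : ℝ) T, ‖S.op t‖ ≤ M) (hT : 0 ≤ T) (ht : t ≤ T) (x : H) :
    ‖S.flow t x‖ ≤ M * ‖x‖ :=
  ContinuousLinearMap.le_of_opNorm_le _ (hM _ ⟨le_max_right _ _, max_le ht hT⟩) _

theorem aestronglyMeasurable_flow [CompleteSpace H] (S : C0Semigroup 𝕜 H) {α : Type}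
    [MeasurableSpace α] {μ : Measure α} {τ : α → ℝ} {k : α → H} (hτ : AEStronglyMeasurable τ μ)
    (hk : AEStronglyMeasurable k μ) : AEStronglyMeasurable (fun a => S.flow (τ a) (k a)) μ :=
  S.continuous_flow.comp_aestronglyMeasurable (hτ.prodMk hk)

theorem intervalIntegrable_flow [CompleteSpace H] (S : C0Semigroup 𝕜 H) {k : ℝ → H} {t : ℝ}
    (ht : 0 ≤ t) (hk : IntervalIntegrable k volume 0 t) :
    IntervalIntegrable (fun s => S.flow (t - s) (k s)) volume 0 t := by
  obtain ⟨M, -, hM⟩ := S.exists_norm_op_le t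
  rw [intervalIntegrable_iff_integrableOn_Ioc_of_le ht] at hk ⊢
  refine Integrable.mono' (hk.norm.const_mul M) (S.aestronglyMeasurable_flow
    (by fun_prop) hk.aestronglyMeasurable) ?_
  filter_upwards [ae_restrict_mem measurableSet_Ioc] with s hs
  exact S.norm_flow_le hM ht (by linarith [hs.1]) _

variable [NormedSpace ℝ H]

/-- The convolution `∫₀ᵗ S_{t-s} k(s) ds` of a `C₀`-semigroup with a forcing term. -/
def duhamel (S : C0Semigroup 𝕜 H) (k : ℝ → H) (t : ℝ) : H :=
  ∫ s in (0 : ℝ)..t, S.flow (t - s) (k s)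

theorem norm_duhamel_le (S : C0Semigroup 𝕜 H) {M T t : ℝ}
    (hM : ∀ t ∈ Set.Icc (0 : ℝ) T, ‖S.op t‖ ≤ M) (ht : t ∈ Set.Icc (0 : ℝ) T) {k : ℝ → H}
    (hk : IntervalIntegrable k volume 0 t) :
    ‖S.duhamel k t‖ ≤ M * ∫ s in (0 : ℝ)..t, ‖k s‖ := by
  rw [← intervalIntegral.integral_const_mul]
  refine intervalIntegral.norm_integral_le_of_norm_le ht.1 ?_ (hk.norm.const_mul M)
  exact Eventually.of_forall fun s hs =>
    S.norm_flow_le hM (ht.1.trans ht.2) (by linarith [hs.1, ht.2]) _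

variable [CompleteSpace H]

theorem duhamel_sub (S : C0Semigroup 𝕜 H) {k l : ℝ → H} {t : ℝ} (ht : 0 ≤ t)
    (hk : IntervalIntegrable k volume 0 t) (hl : IntervalIntegrable l volume 0 t) :
    S.duhamel (fun s => k s - l s) t = S.duhamel k t - S.duhamel l t := by
  simp only [duhamel, flow_sub]
  exact intervalIntegral.integral_sub (S.intervalIntegrable_flow ht hk)
    (S.intervalIntegrable_flow ht hl)

/-- The forcing is only integrable, as f' will be. Written over the fixed interval (0, T] with an
indicator, the integrand is continuous in the time variable at t for each s ≠ t, and dominated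
convergence applies. -/
theorem continuousOn_duhamel (S : C0Semigroup 𝕜 H) {T : ℝ} {k : ℝ → H}
    (hk : IntervalIntegrable k volume 0 T) : ContinuousOn (S.duhamel k) (Set.Icc 0 T) := by
  intro t ht
  have hT : 0 ≤ T := ht.1.trans ht.2
  obtain ⟨M, hM0, hM⟩ := S.exists_norm_op_le T
  rw [intervalIntegrable_iff_integrableOn_Ioc_of_le hT] at hk
  have hrepr : ∀ r ∈ Set.Icc (0 : ℝ) T, S.duhamel k r =
      ∫ s in Set.Ioc 0 T, Set.indicator (Set.Iic r) (fun s => S.flow (r - s) (k s)) s := by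
    intro r hr
    rw [setIntegral_indicator measurableSet_Iic, Set.Ioc_inter_Iic, min_eq_right hr.2, duhamel,
      intervalIntegral.integral_of_le hr.1]
  refine ContinuousWithinAt.congr ?_ hrepr (hrepr t ht)
  refine continuousWithinAt_of_dominated (bound := fun s => M * ‖k s‖) ?_ ?_
    (hk.norm.const_mul M) ?_
  · exact Eventually.of_forall fun r => (S.aestronglyMeasurable_flow (by fun_prop)
      hk.aestronglyMeasurable).indicator measurableSet_Iic
  · filter_upwards [self_mem_nhdsWithin] with r hr
    filter_upwards [ae_restrict_mem measurableSet_Ioc] with s hs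
    exact (norm_indicator_le_norm_self _ _).trans
      (S.norm_flow_le hM hT (by linarith [hs.1, hr.2]) _)
  · have hne : ∀ᵐ s ∂(volume.restrict (Set.Ioc 0 T)), s ≠ t :=
      ae_restrict_of_ae (Measure.ae_ne volume t)
    filter_upwards [hne] with s hs
    have hcont : Continuous fun r : ℝ => S.flow (r - s) (k s) :=
      S.continuous_flow.comp (by fun_prop : Continuous fun r : ℝ => (r - s, k s))
    refine ContinuousAt.continuousWithinAt ?_
    rcases lt_or_gt_of_ne hs with h | h
    · refine hcont.continuousAt.congr ?_
      filter_upwards [lt_mem_nhds h] with r hr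
      rw [Set.indicator_of_mem (Set.mem_Iic.2 hr.le)]
    · refine (continuousAt_const (y := (0 : H))).congr ?_
      filter_upwards [gt_mem_nhds h] with r hr
      rw [Set.indicator_of_notMem (by simpa using hr)]

section Generator

variable {S : C0Semigroup 𝕜 H} {L : H →ₗ.[𝕜] H}

/-- The integral of an orbit is in the domain of the generator. -/
theorem IsGeneratedBy.integral_orbit_mem_graph [IsScalarTower ℝ 𝕜 H] (hS : S.IsGeneratedBy L)
    {t : ℝ} (ht : 0 ≤ t) (x : H) :
    (∫ s in (0 : ℝ)..t, S.flow s x, S.flow t x - x) ∈ L.graph := by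
  have hc : Continuous fun s : ℝ => S.flow s x :=
    S.continuous_flow.comp (by fun_prop : Continuous fun r : ℝ => (r, x))
  rw [hS]
  -- S_h commutes with the integral, so the difference quotient at the integral is the integral of
  -- the difference quotients of the orbit.
  have hlim := tendsto_integral_differenceQuotient hc t
  rw [S.flow_zero] at hlim
  refine hlim.congr' ?_
  filter_upwards [self_mem_nhdsWithin] with h hh
  have hh0 : (0 : ℝ) ≤ h := (Set.mem_Ioi.1 hh).le
  rw [intervalIntegral.integral_smul, intervalIntegral.integral_sub
    ((by fun_prop : Continuous fun s => S.flow (s + h) x).intervalIntegrable _ _)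
    (hc.intervalIntegrable _ _),
    ← ContinuousLinearMap.intervalIntegral_comp_comm _ (hc.intervalIntegrable _ _)]
  congr 2
  refine intervalIntegral.integral_congr fun s hs => ?_
  rw [Set.uIcc_of_le ht] at hs
  simp only [add_comm s h]
  rw [S.flow_add_apply hh0 hs.1, S.flow_of_nonneg hh0]

/-- The time integral of a Duhamel convolution is in the domain of the generator. -/
theorem IsGeneratedBy.integral_duhamel_mem_graph [IsScalarTower ℝ 𝕜 H] (hS : S.IsGeneratedBy L)
    (hL : L.IsClosed) {t : ℝ} (ht : 0 ≤ t) {k : ℝ → H} (hk : IntervalIntegrable k volume 0 t) :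
    (∫ τ in (0 : ℝ)..t, S.duhamel k τ, S.duhamel k t - ∫ s in (0 : ℝ)..t, k s) ∈ L.graph := by
  obtain ⟨M, hM0, hM⟩ := S.exists_norm_op_le t
  have hk' := (intervalIntegrable_iff_integrableOn_Ioc_of_le ht).1 hk
  have hint : Integrable (Function.uncurry fun τ s => S.flow (τ - s) (k s))
      ((volume.restrict (Set.Ioc 0 t)).prod (volume.restrict (Set.Ioc 0 t))) := by
    refine Integrable.mono' ((hk'.comp_snd _).norm.const_mul M)
      (S.aestronglyMeasurable_flow (by fun_prop) hk'.aestronglyMeasurable.comp_snd) ?_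
    rw [Measure.prod_restrict]
    filter_upwards [ae_restrict_mem (measurableSet_Ioc.prod measurableSet_Ioc)] with p hp
    exact S.norm_flow_le hM ht (by linarith [hp.1.2, hp.2.1]) _
  have hshift : ∀ s, ∫ τ in s..t, S.flow (τ - s) (k s) =
      ∫ τ in (0 : ℝ)..(t - s), S.flow τ (k s) := fun s => by
    rw [intervalIntegral.integral_comp_sub_right (fun τ => S.flow τ (k s)), sub_self]
  have hfub : ∫ τ in (0 : ℝ)..t, S.duhamel k τ =
      ∫ s in Set.Ioc 0 t, ∫ τ in (0 : ℝ)..(t - s), S.flow τ (k s) := by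
    simp only [duhamel, integral_integral_triangle ht hint, hshift]
    rw [intervalIntegral.integral_of_le ht]
  have hsub : S.duhamel k t - ∫ s in (0 : ℝ)..t, k s =
      ∫ s in Set.Ioc 0 t, (S.flow (t - s) (k s) - k s) := by
    rw [duhamel, ← intervalIntegral.integral_sub (S.intervalIntegrable_flow ht hk) hk,
      intervalIntegral.integral_of_le ht]
  have hi2 : IntegrableOn (fun s => S.flow (t - s) (k s) - k s) (Set.Ioc 0 t) :=
    ((intervalIntegrable_iff_integrableOn_Ioc_of_le ht).1 (S.intervalIntegrable_flow ht hk)).sub hk'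
  -- The inner integral is a partial integral of the integrable function on the triangle s < τ.
  have hi1 : IntegrableOn (fun s => ∫ τ in (0 : ℝ)..(t - s), S.flow τ (k s)) (Set.Ioc 0 t) := by
    have hind := (hint.indicator (measurableSet_lt measurable_snd measurable_fst)).integral_prod_right
    refine hind.congr ?_
    filter_upwards [ae_restrict_mem measurableSet_Ioc] with s hs
    rw [← hshift]
    have : (fun τ => Set.indicator {p : ℝ × ℝ | p.2 < p.1}
        (Function.uncurry fun τ s => S.flow (τ - s) (k s)) (τ, s)) =
        Set.indicator (Set.Ioi s) (fun τ => S.flow (τ - s) (k s)) := by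
      ext τ
      simp [Set.indicator_apply]
    simp only [this]
    rw [setIntegral_indicator measurableSet_Ioi, intervalIntegral.integral_of_le hs.2,
      Set.Ioc_inter_Ioi, max_eq_right hs.1.le]
  -- The pair is now an integral over s of elements of the graph, one for each orbit of k(s), and
  -- the graph is closed.
  rw [hfub, hsub, ← integral_pair hi1 hi2]
  refine integral_mem_of_isClosed hL (hi1.prodMk hi2) ?_
  filter_upwards [ae_restrict_mem measurableSet_Ioc] with s hs
  exact hS.integral_orbit_mem_graph (sub_nonneg.2 hs.2) _

end Generator

end C0Semigroup

/-! ### Lipschitz functions as integrals, through weak compactness. -/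

/-- A bounded family in a Hilbert space has a weak limit along every ultrafilter. -/
theorem exists_tendsto_inner_of_bounded (𝕜 : Type) [RCLike 𝕜] {E : Type} [NormedAddCommGroup E]
    [InnerProductSpace 𝕜 E] [CompleteSpace E] {ι : Type} (U : Ultrafilter ι) {e : ι → E} {R : ℝ}
    (he : ∀ i, ‖e i‖ ≤ R) :
    ∃ g : E, ∀ y : E, Tendsto (fun i => inner 𝕜 (e i) y) U (𝓝 (inner 𝕜 g y)) := by
  -- Banach–Alaoglu in the dual, transported by the Riesz isometry.
  obtain ⟨φ, -, hφ⟩ := (WeakDual.isCompact_closedBall (𝕜 := 𝕜) (E := E) 0 R).ultrafilter_le_nhds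
    (U.map fun i => StrongDual.toWeakDual (InnerProductSpace.toDual 𝕜 E (e i))) (by
      rw [le_principal_iff, Ultrafilter.mem_coe, Ultrafilter.mem_map]
      refine univ_mem' fun i => ?_
      simpa using he i)
  refine ⟨(InnerProductSpace.toDual 𝕜 E).symm (WeakDual.toStrongDual φ), fun y => ?_⟩
  rw [InnerProductSpace.toDual_symm_apply]
  exact ((WeakDual.eval_continuous y).tendsto φ).comp hφ

/-- A Lipschitz function with values in a Hilbert space is the integral of an integrable
function. -/
theorem LipschitzWith.exists_integral_eq_sub (𝕜 : Type) [RCLike 𝕜] {H : Type}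
    [NormedAddCommGroup H] [InnerProductSpace 𝕜 H] [NormedSpace ℝ H] [CompleteSpace H]
    {K : NNReal} {f : ℝ → H} (hf : LipschitzWith K f) {T : ℝ} (hT : 0 ≤ T) :
    ∃ g : ℝ → H, IntervalIntegrable g volume 0 T ∧
      ∀ t ∈ Set.Icc (0 : ℝ) T, ∫ s in (0 : ℝ)..t, g s = f t - f 0 := by
  set μ : Measure ℝ := volume.restrict (Set.Ioc 0 T) with hμ
  have hcont : ∀ h : ℝ, Continuous fun s => h⁻¹ • (f (s + h) - f s) := fun h => by
    have := hf.continuous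
    fun_prop
  have hbound : ∀ h s : ℝ, ‖h⁻¹ • (f (s + h) - f s)‖ ≤ K := by
    intro h s
    have h1 := hf.dist_le_mul (s + h) s
    rw [dist_eq_norm, dist_eq_norm, add_sub_cancel_left] at h1
    rw [norm_smul, norm_inv]
    -- At h = 0 the quotient vanishes because 0⁻¹ = 0.
    rcases eq_or_ne h 0 with rfl | hh
    · simp
    · rw [inv_mul_le_iff₀ (norm_pos_iff.2 hh), mul_comm]
      exact h1
  have hmem : ∀ h : ℝ, MemLp (fun s => h⁻¹ • (f (s + h) - f s)) 2 μ := fun h =>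
    MemLp.of_bound (hcont h).aestronglyMeasurable K (Eventually.of_forall (hbound h))
  -- The candidate for f' is a weak limit in L²((0,T]; H) of the difference quotients, which are
  -- bounded by K. An ultrafilter finer than h → 0+ replaces the choice of a subsequence.
  obtain ⟨g, hg⟩ := exists_tendsto_inner_of_bounded 𝕜 (Ultrafilter.of (𝓝[>] (0 : ℝ)))
    (e := fun h => (hmem h).toLp) fun h => Lp.norm_le_of_ae_bound K.2 (by
      filter_upwards [(hmem h).coeFn_toLp] with s hs
      rw [hs]
      exact hbound h s)
  have hgi : IntegrableOn g (Set.Ioc 0 T) := (Lp.memLp g).integrable one_le_two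
  refine ⟨g, (intervalIntegrable_iff_integrableOn_Ioc_of_le hT).2 hgi, fun t ht => ?_⟩
  have hrestr : μ.restrict (Set.Ioc 0 t) = volume.restrict (Set.Ioc 0 t) := by
    rw [hμ, Measure.restrict_restrict measurableSet_Ioc,
      Set.inter_eq_left.2 (Set.Ioc_subset_Ioc_right ht.2)]
  refine ext_inner_right 𝕜 fun x => ?_
  -- Testing against 1_{(0,t]} x turns weak L² convergence into weak convergence of the integrals
  -- over (0, t].
  have hinner : ∀ v : Lp H 2 μ, inner 𝕜 v
      (indicatorConstLp 2 (μ := μ) measurableSet_Ioc (measure_ne_top μ (Set.Ioc 0 t)) x) =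
      inner 𝕜 (∫ s in (0 : ℝ)..t, v s) x := fun v => by
    rw [← inner_conj_symm, L2.inner_indicatorConstLp_eq_inner_setIntegral, inner_conj_symm, hrestr,
      intervalIntegral.integral_of_le ht.1]
  have h1 := hg (indicatorConstLp 2 (μ := μ) measurableSet_Ioc (measure_ne_top μ (Set.Ioc 0 t)) x)
  simp only [hinner] at h1
  have h2 : Tendsto (fun h : ℝ => inner 𝕜 (∫ s in (0 : ℝ)..t, h⁻¹ • (f (s + h) - f s)) x)
      (Ultrafilter.of (𝓝[>] (0 : ℝ))) (𝓝 (inner 𝕜 (f t - f 0) x)) :=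
    ((tendsto_integral_differenceQuotient hf.continuous t).mono_left
      (Ultrafilter.of_le _)).inner tendsto_const_nhds
  refine tendsto_nhds_unique h1 (h2.congr fun h => ?_)
  congr 1
  rw [intervalIntegral.integral_of_le ht.1, intervalIntegral.integral_of_le ht.1]
  refine integral_congr_ae ?_
  rw [← hrestr]
  exact (ae_restrict_of_ae (hmem h).coeFn_toLp).mono fun s hs => hs.symm

/-! ### Grönwall and Volterra. -/

/-- Grönwall's inequality in integral form. -/
theorem le_mul_exp_of_le_add_integral {φ : ℝ → ℝ} (hφ : Continuous φ) {a b T : ℝ}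
    (ha : 0 ≤ a) (hb : 0 ≤ b) (hpos : ∀ t, 0 ≤ φ t)
    (h : ∀ t ∈ Set.Icc (0 : ℝ) T, φ t ≤ a + b * ∫ s in (0 : ℝ)..t, φ s) :
    ∀ t ∈ Set.Icc (0 : ℝ) T, φ t ≤ a * Real.exp (b * T) := by
  have hd : ∀ t, HasDerivAt (fun t => ∫ s in (0 : ℝ)..t, φ s) (φ t) t := fun t =>
    intervalIntegral.integral_hasDerivAt_right (hφ.intervalIntegrable _ _)
      (hφ.stronglyMeasurableAtFilter _ _) hφ.continuousAt
  have hnn : ∀ t, 0 ≤ t → 0 ≤ ∫ s in (0 : ℝ)..t, φ s := fun t ht =>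
    intervalIntegral.integral_nonneg ht fun s _ => hpos s
  -- The differential form is applied to the primitive of φ: its derivative is at most b times
  -- itself plus a, and it starts at 0.
  have hG := norm_le_gronwallBound_of_norm_deriv_right_le (a := 0) (b := T) (δ := 0) (K := b)
    (ε := a) (fun t _ => (hd t).continuousAt.continuousWithinAt)
    (fun t _ => (hd t).hasDerivWithinAt) (by simp) (fun t ht => by
      rw [Real.norm_of_nonneg (hpos t), Real.norm_of_nonneg (hnn t ht.1), add_comm]
      exact h t ⟨ht.1, ht.2.le⟩)
  intro t ht
  have h1 := hG t ht
  rw [Real.norm_of_nonneg (hnn t ht.1), sub_zero] at h1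
  have h2 : a + b * gronwallBound 0 b a t ≤ a * Real.exp (b * T) := by
    have hexp : Real.exp (b * t) ≤ Real.exp (b * T) :=
      Real.exp_le_exp.2 (mul_le_mul_of_nonneg_left ht.2 hb)
    rcases eq_or_ne b 0 with rfl | hb0
    · simp
    · rw [gronwallBound_of_K_ne_0 hb0]
      have : a + b * (0 * Real.exp (b * t) + a / b * (Real.exp (b * t) - 1)) =
          a * Real.exp (b * t) := by
        field_simp
        ring
      rw [this]
      exact mul_le_mul_of_nonneg_left hexp ha
  exact (h t ht).trans ((add_le_add_right (mul_le_mul_of_nonneg_left h1 hb) a).trans h2)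

/-- A Volterra integral equation of the second kind has a solution. -/
theorem exists_fixedPoint_of_volterra {H : Type} [NormedAddCommGroup H] [CompleteSpace H] {T : ℝ}
    (hT : 0 ≤ T) {C : ℝ} (hC : 0 ≤ C)
    (Φ : C(Set.Icc (0 : ℝ) T, H) → C(Set.Icc (0 : ℝ) T, H))
    (hΦ : ∀ u v t, ‖Φ u t - Φ v t‖ ≤
      C * ∫ s in (0 : ℝ)..t, ‖u (Set.projIcc 0 T hT s) - v (Set.projIcc 0 T hT s)‖) :
    ∃ u, Φ u = u := by
  -- Iterating the estimate gains 1/n!, so some iterate of `Φ` is a contraction, and its fixed point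
  -- is fixed by `Φ` too.
  have key : ∀ (n : ℕ) (u v : C(Set.Icc (0 : ℝ) T, H)) (t : Set.Icc (0 : ℝ) T),
      ‖Φ^[n] u t - Φ^[n] v t‖ ≤ (C * t) ^ n / n.factorial * ‖u - v‖ := by
    intro n
    induction n with
    | zero =>
      intro u v t
      simpa using (u - v).norm_coe_le_norm t
    | succ n ih =>
      intro u v t
      rw [Function.iterate_succ_apply', Function.iterate_succ_apply']
      refine (hΦ _ _ t).trans ?_
      have hle : ∫ s in (0 : ℝ)..t,
          ‖Φ^[n] u (Set.projIcc 0 T hT s) - Φ^[n] v (Set.projIcc 0 T hT s)‖ ≤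
          ∫ s in (0 : ℝ)..t, (C * s) ^ n / n.factorial * ‖u - v‖ := by
        refine intervalIntegral.integral_mono_on t.2.1 (Continuous.intervalIntegrable
          (by fun_prop) _ _) (Continuous.intervalIntegrable (by fun_prop) _ _) fun s hs => ?_
        have := ih u v (Set.projIcc 0 T hT s)
        rwa [Set.projIcc_of_mem hT ⟨hs.1, hs.2.trans t.2.2⟩] at this ⊢
      refine (mul_le_mul_of_nonneg_left hle hC).trans (le_of_eq ?_)
      have : ∀ s : ℝ, (C * s) ^ n / n.factorial * ‖u - v‖ =
          C ^ n / n.factorial * ‖u - v‖ * s ^ n := fun s => by ring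
      simp only [this]
      rw [intervalIntegral.integral_const_mul, integral_pow,
        Nat.factorial_succ]
      push_cast
      field_simp
      simp only [ne_eq, Nat.add_eq_zero_iff, one_ne_zero, and_false, not_false_eq_true, zero_pow,
        sub_zero]
      ring
  obtain ⟨n, hn⟩ := ((FloorSemiring.tendsto_pow_div_factorial_atTop (C * T)).eventually
    (gt_mem_nhds one_pos)).exists
  have hpos : 0 ≤ (C * T) ^ n / n.factorial := by positivity
  have hcontr : ContractingWith ⟨_, hpos⟩ Φ^[n] := by
    refine ⟨by exact_mod_cast hn, LipschitzWith.of_dist_le_mul fun u v => ?_⟩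
    rw [dist_eq_norm, dist_eq_norm, ContinuousMap.norm_le _ (by positivity)]
    intro t
    refine (key n u v t).trans (mul_le_mul_of_nonneg_right ?_ (norm_nonneg _))
    have := t.2.1
    have := t.2.2
    change (C * (t : ℝ)) ^ n / n.factorial ≤ (C * T) ^ n / n.factorial
    gcongr
  exact ⟨_, hcontr.isFixedPt_fixedPoint_iterate⟩

/-! ### Variation of constants and solvability of the perturbed Cauchy problem. -/

namespace C0Semigroup

variable {𝕜 : Type} [RCLike 𝕜] {H : Type} [NormedAddCommGroup H] [CompleteSpace H]
  [NormedSpace ℝ H]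

section Banach

variable [NormedSpace 𝕜 H] [IsScalarTower ℝ 𝕜 H] {S : C0Semigroup 𝕜 H} {L : H →ₗ.[𝕜] H}

/-- Variation of constants: a solution of `u' = L u + k` is a mild solution. -/
theorem IsGeneratedBy.eq_flow_add_duhamel (hS : S.IsGeneratedBy L) {T : ℝ} {u k : ℝ → H}
    (hu : Continuous u) (hk : Continuous k)
    (hderiv : ∀ s ∈ Set.Ioo (0 : ℝ) T,
      ∃ y, (u s, y) ∈ L.graph ∧ HasDerivWithinAt u (y + k s) (Set.Ioi s) s)
    {t : ℝ} (ht : t ∈ Set.Icc (0 : ℝ) T) : u t = S.flow t (u 0) + S.duhamel k t := by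
  have hcomp : ∀ {v : ℝ → H}, Continuous v → Continuous fun s => S.flow (t - s) (v s) :=
    fun {v} hv => S.continuous_flow.comp (by fun_prop : Continuous fun s : ℝ => (t - s, v s))
  have hFTC := intervalIntegral.integral_eq_sub_of_hasDeriv_right_of_le ht.1
    (hcomp hu).continuousOn (f' := fun s => S.flow (t - s) (k s)) ?_
    ((hcomp hk).intervalIntegrable _ _)
  · rw [duhamel, hFTC, sub_self, sub_zero, S.flow_zero]
    abel
  intro s hs
  obtain ⟨y, hy, hd⟩ := hderiv s ⟨hs.1, hs.2.trans_le ht.2⟩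
  rw [hasDerivWithinAt_iff_tendsto_slope' Set.self_notMem_Ioi] at hd ⊢
  have hshift : Tendsto (fun r : ℝ => r - s) (𝓝[>] s) (𝓝[>] 0) := by
    refine tendsto_nhdsWithin_iff.2 ⟨?_, ?_⟩
    · have : Continuous fun r : ℝ => r - s := by fun_prop
      simpa using (this.tendsto s).mono_left nhdsWithin_le_nhds
    · filter_upwards [self_mem_nhdsWithin] with r hr
      simpa using hr
  -- For r > s the slope of s ↦ S_{t-s} u(s) is S_{t-r} applied to the slope of u minus the
  -- difference quotient of the semigroup at u(s). The argument tends to (y + k(s)) - y = k(s), and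
  -- joint continuity of the flow gives S_{t-s} k(s).
  have hin := hd.sub (((hS _ _).1 hy).comp hshift)
  rw [add_sub_cancel_left] at hin
  have hts : Tendsto (fun r : ℝ => t - r) (𝓝[>] s) (𝓝 (t - s)) :=
    ((continuous_const.sub continuous_id).tendsto s).mono_left nhdsWithin_le_nhds
  refine ((S.continuous_flow.tendsto (t - s, k s)).comp (hts.prodMk_nhds hin)).congr' ?_
  filter_upwards [self_mem_nhdsWithin, mem_nhdsWithin_of_mem_nhds (gt_mem_nhds hs.2)] with r hr hrt
  have hr0 : 0 ≤ r - s := (sub_pos.2 hr).le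
  have hsplit : S.flow (t - s) (u s) = S.flow (t - r) (S.op (r - s) (u s)) := by
    rw [← S.flow_of_nonneg hr0, ← S.flow_add_apply (sub_nonneg.2 (le_of_lt hrt)) hr0]
    congr 1
    ring
  simp only [Function.comp_apply, slope_def_module, hsplit, ← S.flow_sub]
  rw [← smul_sub, sub_sub_sub_cancel_right]
  exact ContinuousLinearMap.map_smul_of_tower _ _ _

/-- The a priori bound for mild solutions of `u' = L u + B u + f`. -/
theorem norm_le_of_eq_duhamel {H : Type} [NormedAddCommGroup H] [NormedSpace ℝ H]
    [NormedSpace 𝕜 H] (S : C0Semigroup 𝕜 H) (B : H →L[𝕜] H) {T M : ℝ}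
    (hM0 : 0 ≤ M) (hM : ∀ t ∈ Set.Icc (0 : ℝ) T, ‖S.op t‖ ≤ M) {u f : ℝ → H}
    (hu : Continuous u) (hf : Continuous f) {C : ℝ} (hC : ∀ t, ‖f t‖ ≤ C)
    (h : ∀ t ∈ Set.Icc (0 : ℝ) T,
      u t = S.flow t (u 0) + S.duhamel (fun s => B (u s) + f s) t) :
    ∀ t ∈ Set.Icc (0 : ℝ) T,
      ‖u t‖ ≤ (M * ‖u 0‖ + M * (T * C)) * Real.exp (M * ‖B‖ * T) := by
  rcases lt_or_ge T 0 with hT | hT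
  · intro t ht
    exact absurd (ht.1.trans ht.2) (not_le.2 hT)
  have hC0 : 0 ≤ C := (norm_nonneg _).trans (hC 0)
  refine le_mul_exp_of_le_add_integral hu.norm (by positivity) (by positivity)
    (fun t => norm_nonneg _) fun t ht => ?_
  have hk : Continuous fun s => B (u s) + f s := by fun_prop
  have h1 : ∫ s in (0 : ℝ)..t, ‖B (u s) + f s‖ ≤ ∫ s in (0 : ℝ)..t, (‖B‖ * ‖u s‖ + C) :=
    intervalIntegral.integral_mono_on ht.1 (hk.norm.intervalIntegrable _ _)
      (Continuous.intervalIntegrable (by fun_prop) _ _) fun s _ =>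
        (norm_add_le _ _).trans (add_le_add (B.le_opNorm _) (hC s))
  rw [intervalIntegral.integral_add (Continuous.intervalIntegrable (by fun_prop) _ _)
    (Continuous.intervalIntegrable (by fun_prop) _ _), intervalIntegral.integral_const_mul,
    intervalIntegral.integral_const, sub_zero, smul_eq_mul] at h1
  have h2 := S.norm_duhamel_le hM ht (hk.intervalIntegrable _ _)
  have h3 := S.norm_flow_le hM hT ht.2 (u 0)
  have h4 : t * C ≤ T * C := mul_le_mul_of_nonneg_right ht.2 hC0
  calc ‖u t‖ ≤ M * ‖u 0‖ + M * (‖B‖ * (∫ s in (0 : ℝ)..t, ‖u s‖) + T * C) := by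
        nth_rewrite 1 [h t ht]
        refine (norm_add_le _ _).trans (add_le_add h3 (h2.trans ?_))
        exact mul_le_mul_of_nonneg_left (h1.trans (by gcongr)) hM0
    _ = _ := by ring

end Banach

variable [InnerProductSpace 𝕜 H] [IsScalarTower ℝ 𝕜 H] {S : C0Semigroup 𝕜 H} {L : H →ₗ.[𝕜] H}

/-- The problem `u' = L u + B u + f`, `u 0 = g`, with `B` bounded, `f` Lipschitz continuous and `g`
in the domain of the generator `L`, has a continuously differentiable solution. -/
theorem IsGeneratedBy.exists_solution (hS : S.IsGeneratedBy L) (hL : L.IsClosed) (B : H →L[𝕜] H)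
    {T : ℝ} (hT : 0 ≤ T) {K : NNReal} {f : ℝ → H} (hf : LipschitzWith K f) {g y : H}
    (hg : (g, y) ∈ L.graph) :
    ∃ u w : ℝ → H, Continuous w ∧ u 0 = g ∧ (∀ t, HasDerivAt u (w t) t) ∧
      ∀ t ∈ Set.Icc (0 : ℝ) T, (u t, w t - B (u t) - f t) ∈ L.graph := by
  obtain ⟨f', hf', hff'⟩ := LipschitzWith.exists_integral_eq_sub 𝕜 hf hT
  obtain ⟨M, hM0, hM⟩ := S.exists_norm_op_le T
  have hsub : ∀ {k : ℝ → H} {t}, IntervalIntegrable k volume 0 T → t ∈ Set.Icc (0 : ℝ) T →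
      IntervalIntegrable k volume 0 t := fun hk ht => hk.mono_set (by
    rw [Set.uIcc_of_le ht.1, Set.uIcc_of_le hT]
    exact Set.Icc_subset_Icc_right ht.2)
  -- The value of u'(0) that the equation dictates, since y = L g.
  set x : H := y + B g + f 0
  have horbit : Continuous fun t => S.flow t x :=
    S.continuous_flow.comp (by fun_prop : Continuous fun r : ℝ => (r, x))
  let ext : C(Set.Icc (0 : ℝ) T, H) → ℝ → H := fun w s => w (Set.projIcc 0 T hT s)
  have hext : ∀ w, Continuous (ext w) := fun w => w.continuous.comp continuous_projIcc
  have hk : ∀ w, IntervalIntegrable (fun s => f' s + B (ext w s)) volume 0 T := fun w =>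
    hf'.add ((B.continuous.comp (hext w)).intervalIntegrable _ _)
  let Φ : C(Set.Icc (0 : ℝ) T, H) → C(Set.Icc (0 : ℝ) T, H) := fun w =>
    ⟨(Set.Icc (0 : ℝ) T).domRestrict
      fun t => S.flow t x + S.duhamel (fun s => f' s + B (ext w s)) t,
      (horbit.continuousOn.add (S.continuousOn_duhamel (hk w))).domRestrict⟩
  -- w is the future u': a fixed point of the differentiated equation in mild form.
  obtain ⟨w, hw⟩ := exists_fixedPoint_of_volterra hT (C := M * ‖B‖) (by positivity) Φ (by
    intro u v t
    have h1 : Φ u t - Φ v t = S.duhamel (fun s => B (ext u s - ext v s)) t := by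
      change (S.flow t x + S.duhamel (fun s => f' s + B (ext u s)) t) -
        (S.flow t x + S.duhamel (fun s => f' s + B (ext v s)) t) = _
      rw [add_sub_add_left_eq_sub, ← S.duhamel_sub t.2.1 (hsub (hk u) t.2) (hsub (hk v) t.2)]
      simp
    have hc : Continuous fun s => ext u s - ext v s := (hext u).sub (hext v)
    rw [h1, mul_assoc, ← intervalIntegral.integral_const_mul]
    refine (S.norm_duhamel_le hM t.2 ((B.continuous.comp hc).intervalIntegrable _ _)).trans
      (mul_le_mul_of_nonneg_left ?_ hM0)
    exact intervalIntegral.integral_mono_on t.2.1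
      ((B.continuous.comp hc).norm.intervalIntegrable _ _)
      ((hc.norm.const_mul ‖B‖).intervalIntegrable _ _) fun s _ => B.le_opNorm _)
  have hwt : ∀ t ∈ Set.Icc (0 : ℝ) T,
      ext w t = S.flow t x + S.duhamel (fun s => f' s + B (ext w s)) t := fun t ht => by
    have h1 : Φ w ⟨t, ht⟩ = w ⟨t, ht⟩ := by rw [hw]
    simp only [ext, Set.projIcc_of_mem hT ht]
    exact h1.symm
  have hwI : ∀ a b, IntervalIntegrable (ext w) volume a b :=
    fun a b => (hext w).intervalIntegrable a b
  refine ⟨fun t => g + ∫ s in (0 : ℝ)..t, ext w s, ext w, hext w, by simp, fun t => ?_,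
    fun t ht => ?_⟩
  · exact (intervalIntegral.integral_hasDerivAt_right (hwI _ _)
      ((hext w).stronglyMeasurableAtFilter _ _) (hext w).continuousAt).const_add g
  · have hkt := hsub (hk w) ht
    have hD := hS.integral_duhamel_mem_graph hL ht.1 hkt
    -- Adding the graph elements over g, ∫ S_s x and the integrated convolution gives u(t) in the
    -- first component. In the second, the choice of x cancels y, B g and f(0) and leaves w - B u -
    -- f.
    have hmem := L.graph.add_mem hg
      (L.graph.add_mem (hS.integral_orbit_mem_graph ht.1 x) hD)
    have h1 : ∫ s in (0 : ℝ)..t, ext w s = (∫ s in (0 : ℝ)..t, S.flow s x) +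
        ∫ s in (0 : ℝ)..t, S.duhamel (fun s => f' s + B (ext w s)) s := by
      rw [← intervalIntegral.integral_add (horbit.intervalIntegrable _ _)
        ((S.continuousOn_duhamel hkt).intervalIntegrable_of_Icc ht.1)]
      refine intervalIntegral.integral_congr fun s hs => ?_
      rw [Set.uIcc_of_le ht.1] at hs
      exact hwt s ⟨hs.1, hs.2.trans ht.2⟩
    have h2 : ∫ s in (0 : ℝ)..t, (f' s + B (ext w s)) =
        f t - f 0 + B (∫ s in (0 : ℝ)..t, ext w s) := by
      have hBw : IntervalIntegrable (fun s => B (ext w s)) volume 0 t :=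
        (B.continuous.comp (hext w)).intervalIntegrable _ _
      rw [intervalIntegral.integral_add (hsub hf' ht) hBw, hff' t ht,
        ContinuousLinearMap.intervalIntegral_comp_comm _ (hwI _ _)]
    rw [h2] at hmem
    convert! hmem using 1
    refine Prod.ext ?_ ?_
    · simp [h1]
    · simp only [Prod.snd_add, hwt t ht, map_add, x]
      abel

end C0Semigroup

/-! ### Membership in the Kondratiev spaces -/

theorem one_le_kondratievWeight (γ : MultiIndex) : 1 ≤ kondratievWeight γ :=
  Finset.prod_induction _ (fun x : ℝ => 1 ≤ x) (fun _ _ => one_le_mul_of_one_le_of_one_le) le_rfl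
    fun k _ => one_le_pow₀ (by
      have : (0 : ℝ) ≤ k := k.cast_nonneg
      linarith)

theorem ChaosExpansion.MemKondratiev.mono {Y : Type} [NormedAddCommGroup Y] {f : ChaosExpansion Y}
    {p r : ℝ} (hf : f.MemKondratiev p) (hpr : p ≤ r) : f.MemKondratiev r := by
  refine Summable.of_nonneg_of_le (fun γ => ?_) (fun γ => ?_) hf
  · have := (zero_lt_one.trans_le (one_le_kondratievWeight γ)).le
    positivity
  · exact mul_le_mul_of_nonneg_left
      (Real.rpow_le_rpow_of_exponent_le (one_le_kondratievWeight γ) (neg_le_neg hpr)) (by positivity)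

/-- This rests on (a + b)² ≤ 2 (a² + b²). As C does not depend on γ, the exponent r is not
increased. -/
theorem ChaosExpansion.MemKondratiev.of_norm_le {X Y Z : Type} [NormedAddCommGroup X]
    [NormedAddCommGroup Y] [NormedAddCommGroup Z] {f : ChaosExpansion X} {g : ChaosExpansion Y}
    {u : ChaosExpansion Z} {r : ℝ} (hf : f.MemKondratiev r) (hg : g.MemKondratiev r) {C : ℝ}
    (hu : ∀ γ, ‖u γ‖ ≤ C * (‖g γ‖ + ‖f γ‖)) : u.MemKondratiev r := by
  refine Summable.of_nonneg_of_le (fun γ => ?_) (fun γ => ?_)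
    ((Summable.add hg hf).mul_left (2 * C ^ 2))
  · have := (zero_lt_one.trans_le (one_le_kondratievWeight γ)).le
    positivity
  · have hw := (zero_lt_one.trans_le (one_le_kondratievWeight γ)).le
    rw [← add_mul, ← mul_assoc]
    refine mul_le_mul_of_nonneg_right ?_ (by positivity)
    calc ‖u γ‖ ^ 2 ≤ (C * (‖g γ‖ + ‖f γ‖)) ^ 2 := pow_le_pow_left₀ (norm_nonneg _) (hu γ) 2
      _ ≤ 2 * C ^ 2 * (‖g γ‖ ^ 2 + ‖f γ‖ ^ 2) := by
        nlinarith [mul_nonneg (sq_nonneg C) (sq_nonneg (‖g γ‖ - ‖f γ‖))]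

/-! ### The deterministic problem -/

variable {𝕜 : Type} [RCLike 𝕜] {d : ℕ}

/-- Multiplication by a bounded potential, as a bounded operator on `L²`. -/
def potentialCLM (q : LInf 𝕜 d) : L2 𝕜 d →L[𝕜] L2 𝕜 d :=
  LinearMap.mkContinuous
    { toFun := potentialMul q
      map_add' := fun u v => Lp.add_smul q u v
      map_smul' := fun c u => (Lp.smul_comm c q u).symm } ‖q‖ fun u => Lp.norm_smul_le q u

theorem potentialCLM_apply (q : LInf 𝕜 d) (u : L2 𝕜 d) : potentialCLM q u = potentialMul q u := rfl

variable {T : ℝ} {L : L2 𝕜 d →ₗ.[𝕜] L2 𝕜 d} {q : LInf 𝕜 d}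

/-- Linearity, by which uniqueness will follow from the a priori bound with zero data. -/
theorem IsDeterministicSolution.sub {hT : 0 ≤ T} {f₁ f₂ : C(Set.Icc (0 : ℝ) T, L2 𝕜 d)}
    {g₁ g₂ : L.domain} {u₁ u₂ : C(Set.Icc (0 : ℝ) T, L.domain)}
    (h₁ : IsDeterministicSolution hT L q f₁ g₁ u₁) (h₂ : IsDeterministicSolution hT L q f₂ g₂ u₂) :
    IsDeterministicSolution hT L q (f₁ - f₂) (g₁ - g₂) (u₁ - u₂) where
  initial := by rw [ContinuousMap.sub_apply, h₁.initial, h₂.initial]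
  equation t ht := by
    obtain ⟨v₁, hv₁, he₁⟩ := h₁.equation t ht
    obtain ⟨v₂, hv₂, he₂⟩ := h₂.equation t ht
    refine ⟨v₁ - v₂, HasDerivWithinAt.sub hv₁ hv₂, ?_⟩
    rw [ContinuousMap.sub_apply, ContinuousMap.sub_apply, ← he₁, ← he₂, LinearPMap.map_sub,
      ← potentialCLM_apply, ← potentialCLM_apply, ← potentialCLM_apply, Submodule.coe_sub, map_sub]
    abel

theorem IsDeterministicSolution.eq_flow_add_duhamel {S : C0Semigroup 𝕜 (L2 𝕜 d)}
    (hS : S.IsGeneratedBy L) {hT : 0 ≤ T} {f : C(Set.Icc (0 : ℝ) T, L2 𝕜 d)} {g : L.domain}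
    {u : C(Set.Icc (0 : ℝ) T, L.domain)} (h : IsDeterministicSolution hT L q f g u) {t : ℝ}
    (ht : t ∈ Set.Icc (0 : ℝ) T) :
    (u (Set.projIcc 0 T hT t) : L2 𝕜 d) = S.flow t (u (Set.projIcc 0 T hT 0)) +
      S.duhamel (fun s => (-potentialCLM q) (u (Set.projIcc 0 T hT s)) +
        f (Set.projIcc 0 T hT s)) t := by
  have hu : Continuous fun s => (u (Set.projIcc 0 T hT s) : L2 𝕜 d) :=
    continuous_subtype_val.comp (u.continuous.comp continuous_projIcc)
  have hf : Continuous fun s => f (Set.projIcc 0 T hT s) := f.continuous.comp continuous_projIcc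
  have hk : Continuous fun s => (-potentialCLM q) (u (Set.projIcc 0 T hT s)) +
      f (Set.projIcc 0 T hT s) := ((-potentialCLM q).continuous.comp hu).add hf
  refine hS.eq_flow_add_duhamel hu hk (fun s hs => ?_) ht
  have hs' : s ∈ Set.Icc (0 : ℝ) T := Set.Ioo_subset_Icc_self hs
  obtain ⟨v, hv, he⟩ := h.equation ⟨s, hs'⟩ hs.1
  refine ⟨L (u (Set.projIcc 0 T hT s)), L.mem_graph _, ?_⟩
  have hv' : HasDerivWithinAt (fun s : ℝ => (u (Set.projIcc 0 T hT s) : L2 𝕜 d)) v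
      (Set.Icc 0 T) s := hv
  convert (hv'.hasDerivAt (Icc_mem_nhds hs.1 hs.2)).hasDerivWithinAt using 1
  simp only [Set.projIcc_of_mem hT hs', ← he, neg_apply, potentialCLM_apply]
  abel

/-- The solutions of the deterministic problem depend continuously on the data. -/
theorem exists_norm_le_of_isDeterministicSolution {S : C0Semigroup 𝕜 (L2 𝕜 d)}
    (hS : S.IsGeneratedBy L) (hT : 0 ≤ T) (q : LInf 𝕜 d) :
    ∃ C : ℝ, ∀ (f : C(Set.Icc (0 : ℝ) T, L2 𝕜 d)) (g : L.domain)
      (u : C(Set.Icc (0 : ℝ) T, L.domain)), IsDeterministicSolution hT L q f g u →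
        ‖u‖ ≤ C * (‖g‖ + ‖f‖) := by
  obtain ⟨M, hM0, hM⟩ := S.exists_norm_op_le T
  set E : ℝ := Real.exp (M * ‖-potentialCLM q‖ * T)
  -- M comes from the initial value, M T from the forcing and E from Grönwall; none of them depends
  -- on the data.
  refine ⟨(M + M * T) * E, fun f g u h => ?_⟩
  rw [ContinuousMap.norm_le _ (by positivity)]
  intro t
  have hu0 : u (Set.projIcc 0 T hT 0) = g := by
    rw [← h.initial, Set.projIcc_left]
    rfl
  have hb := S.norm_le_of_eq_duhamel (-potentialCLM q) hM0 hM
    (u := fun s => (u (Set.projIcc 0 T hT s) : L2 𝕜 d)) (f := fun s => f (Set.projIcc 0 T hT s))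
    (continuous_subtype_val.comp (u.continuous.comp continuous_projIcc))
    (f.continuous.comp continuous_projIcc) (fun s => f.norm_coe_le_norm _)
    (fun s hs => h.eq_flow_add_duhamel hS hs) t t.2
  rw [hu0, Set.projIcc_val] at hb
  refine hb.trans ?_
  rw [mul_right_comm (M + M * T)]
  refine mul_le_mul_of_nonneg_right ?_ (Real.exp_pos _).le
  have h1 : 0 ≤ M * ‖f‖ := by positivity
  have h2 : 0 ≤ M * T * ‖(g : L2 𝕜 d)‖ := by positivity
  rw [Submodule.coe_norm]
  linarith

theorem IsDeterministicSolution.unique {S : C0Semigroup 𝕜 (L2 𝕜 d)} (hS : S.IsGeneratedBy L)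
    {hT : 0 ≤ T} {f : C(Set.Icc (0 : ℝ) T, L2 𝕜 d)} {g : L.domain}
    {u v : C(Set.Icc (0 : ℝ) T, L.domain)} (hu : IsDeterministicSolution hT L q f g u)
    (hv : IsDeterministicSolution hT L q f g v) : u = v := by
  obtain ⟨C, hC⟩ := exists_norm_le_of_isDeterministicSolution hS hT q
  have := hC _ _ _ (hu.sub hv)
  rw [sub_self, sub_self, norm_zero, norm_zero, add_zero, mul_zero] at this
  exact sub_eq_zero.1 (norm_le_zero_iff.1 this)

/-- The abstract existence result is used with B = -q and with f frozen outside [0, T], which keeps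
it Lipschitz. Continuity of L u is read off from L u = u' + q u - f. -/
theorem exists_isDeterministicSolution {S : C0Semigroup 𝕜 (L2 𝕜 d)} (hS : S.IsGeneratedBy L)
    (hL : L.IsClosed) (hT : 0 ≤ T) (q : LInf 𝕜 d) {f : C(Set.Icc (0 : ℝ) T, L2 𝕜 d)} {K : NNReal}
    (hf : LipschitzWith K f) (g : L.domain) :
    ∃ u : C(Set.Icc (0 : ℝ) T, L.domain), IsDeterministicSolution hT L q f g u ∧
      Continuous fun t => L (u t) := by
  obtain ⟨u, w, hw, hu0, hd, hgraph⟩ := hS.exists_solution hL (-potentialCLM q) hT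
    (hf.comp (LipschitzWith.projIcc hT)) (L.mem_graph g)
  have hu : Continuous u := continuous_iff_continuousAt.2 fun t => (hd t).continuousAt
  have hmem : ∀ t : Set.Icc (0 : ℝ) T, u t ∈ L.domain :=
    fun t => LinearPMap.mem_domain_of_mem_graph (hgraph t t.2)
  have hLu : ∀ t : Set.Icc (0 : ℝ) T,
      L ⟨u t, hmem t⟩ = w t + potentialMul q (u t) - f t := fun t => by
    have := (LinearPMap.image_iff (hmem t)).2 (hgraph t t.2)
    rw [← this]
    simp [potentialCLM_apply]
  refine ⟨⟨fun t => ⟨u t, hmem t⟩, by fun_prop⟩, ⟨Subtype.ext hu0, fun t ht => ?_⟩, ?_⟩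
  · refine ⟨w t, ?_, ?_⟩
    · refine (hd t).hasDerivWithinAt.congr_of_mem (fun s hs => ?_) t.2
      simp [Set.projIcc_of_mem hT hs]
    · simp only [ContinuousMap.coe_mk, hLu]
      abel
  · simp only [ContinuousMap.coe_mk, hLu, ← potentialCLM_apply]
    fun_prop

/-! ### The stochastic problem -/

/-- The stochastic problem is solved coefficient by coefficient. -/
theorem isStochasticSolution_iff {hT : 0 ≤ T}
    {F : KondratievProcess C(Set.Icc (0 : ℝ) T, L2 𝕜 d)} {G : KondratievProcess L.domain}
    {U : KondratievProcess C(Set.Icc (0 : ℝ) T, L.domain)} :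
    IsStochasticSolution hT L q F G U ↔
      ∀ γ, IsDeterministicSolution hT L q (F.coeff γ) (G.coeff γ) (U.coeff γ) := by
  refine ⟨fun h γ => ⟨congrFun h.initial γ, fun t ht => ?_⟩,
    fun h => ⟨funext fun γ => (h γ).initial, fun t ht => ?_⟩⟩
  · obtain ⟨V, hV, he⟩ := h.equation t ht
    exact ⟨V γ, hV γ, congrFun he γ⟩
  · choose V hV he using fun γ => (h γ).equation t ht
    exact ⟨V, hV, funext he⟩

end StochParabolic

end

theorem mainTheorem4 {𝕜 : Type} [RCLike 𝕜] (d : ℕ) (T : ℝ) (hT : 0 < T)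
    (L : StochParabolic.L2 𝕜 d →ₗ.[𝕜] StochParabolic.L2 𝕜 d)
    (hL : StochParabolic.IsAdmissibleOperator L)
    (F : StochParabolic.KondratievProcess C(Set.Icc (0 : ℝ) T, StochParabolic.L2 𝕜 d))
    (hF : ∀ γ, ∃ K, LipschitzWith K (F.coeff γ))
    (G : StochParabolic.KondratievProcess L.domain)
    (q : StochParabolic.LInf 𝕜 d) :
    ∃ U : StochParabolic.KondratievProcess C(Set.Icc (0 : ℝ) T, L.domain),
      -- `U` solves the stochastic problem and is its only solution
      StochParabolic.IsStochasticSolution hT.le L q F G U ∧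
      (∀ V : StochParabolic.KondratievProcess C(Set.Icc (0 : ℝ) T, L.domain),
        StochParabolic.IsStochasticSolution hT.le L q F G V → V = U) ∧
      -- each coefficient of `U` is the only solution of the deterministic problem
      (∀ γ, StochParabolic.IsDeterministicSolution hT.le L q (F.coeff γ) (G.coeff γ) (U.coeff γ) ∧
        (∀ v : C(Set.Icc (0 : ℝ) T, L.domain),
          StochParabolic.IsDeterministicSolution hT.le L q (F.coeff γ) (G.coeff γ) v →
            v = U.coeff γ) ∧
        -- each coefficient is also continuous for the graph norm of `L`
        Continuous fun t => L (U.coeff γ t)) ∧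
      -- the expansion of `U` converges in `(S)_{-r}` for every `r ≥ max(p₁, p₂)`
      (∀ p₁ p₂ r : ℝ, 0 ≤ p₁ → 0 ≤ p₂ → F.coeff.MemKondratiev p₁ → G.coeff.MemKondratiev p₂ →
        max p₁ p₂ ≤ r → U.coeff.MemKondratiev r) := by

  obtain ⟨hclosed, -, S, hS⟩ := hL
  choose K hK using hF
  choose u hu hLu using fun γ =>
    StochParabolic.exists_isDeterministicSolution hS hclosed hT.le q (hK γ) (G.coeff γ)
  obtain ⟨C, hC⟩ := StochParabolic.exists_norm_le_of_isDeterministicSolution hS hT.le q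
  -- The same C serves every γ, so both data are moved to the common exponent r and compared
  -- termwise.
  have hmem : ∀ p₁ p₂ r : ℝ, F.coeff.MemKondratiev p₁ → G.coeff.MemKondratiev p₂ →
      max p₁ p₂ ≤ r → StochParabolic.ChaosExpansion.MemKondratiev u r :=
    fun p₁ p₂ r h₁ h₂ hr => .of_norm_le (h₁.mono ((le_max_left _ _).trans hr))
      (h₂.mono ((le_max_right _ _).trans hr)) fun γ => hC _ _ _ (hu γ)
  obtain ⟨p₁, hp₁, h₁⟩ := F.exists_mem
  obtain ⟨p₂, -, h₂⟩ := G.exists_mem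
  refine ⟨⟨u, max p₁ p₂, le_max_of_le_left hp₁, hmem p₁ p₂ _ h₁ h₂ le_rfl⟩,
    StochParabolic.isStochasticSolution_iff.2 hu, fun V hV => ?_, fun γ => ⟨hu γ,
    fun v hv => hv.unique hS (hu γ), hLu γ⟩, fun p₁ p₂ r _ _ h₁ h₂ hr => hmem p₁ p₂ r h₁ h₂ hr⟩
  exact StochParabolic.KondratievProcess.ext <| funext fun γ =>
    (StochParabolic.isStochasticSolution_iff.1 hV γ).unique hS (hu γ)
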